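/- Let $s_\lambda=\sum_T x^T$ (sum over all semistandard Young tableaux $T$ of shape $\lambda$) denote the Schur function of a partition $\lambda$ in the variables $x_1,x_2,\dots$, with $s_\emptyset=1$. For integers $a,b$ let $(2^a,1^b)$ be the partition with $a$ parts equal to $2$ and $b$ parts equal to $1$, and set $s_{(2^a,1^b)}=0$ if $a<0$ or $b<0$. For a set $S$ of positive integers and $n\in\mathbb Z$ let $\mathrm{Par}_S(n)$ be the set of partitions of $n$ all of whose parts belong to $S$ (so $\mathrm{Par}_S(n)=\emptyset$ for $n<0$). Then for every integer $m\ge 0$, $$\sum_{i=0}^m\Bigl(s_{(2^{i-1})}s_{(2^{m-i})}+s_{(2^{i-2},1^2)}s_{(2^{m-i})}-s_{(2^{i-1},1)}s_{(2^{m-i-1},1)}\Bigr)=\sum_{\lambda\in\mathrm{Par}_{\{2,4\}}(2m-2)}s_\lambda .$$ Consequently, the symmetric function on the left-hand side is $s$-positive, that is, it is a finite linear combination of Schur functions with nonnegative coefficients. -/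

import Mathlib

/-- The content (type) of a semistandard Young tableau `T`: the finitely supported function sending
`k` to the number of cells of `T` whose entry is `k`. -/
noncomputable def SemistandardYoungTableau.content {μ : YoungDiagram}
    (T : SemistandardYoungTableau μ) : ℕ →₀ ℕ :=
  ∑ c ∈ μ.cells, Finsupp.single (T c.1 c.2) 1

/-- There are only finitely many semistandard tableaux of a given shape and content, so that
counting them by `Nat.card` below is meaningful. -/
theorem SemistandardYoungTableau.finite_content (μ : YoungDiagram) (d : ℕ →₀ ℕ) :
    Finite {T : SemistandardYoungTableau μ // T.content = d} := by
  classical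
  have key : ∀ (T : SemistandardYoungTableau μ), T.content = d →
      ∀ c ∈ μ.cells, T c.1 c.2 ∈ d.support := by
    intro T hT c hc
    rw [← hT, Finsupp.mem_support_iff, SemistandardYoungTableau.content, Finsupp.finsetSum_apply]
    have h2 : (Finsupp.single (T c.1 c.2) 1 : ℕ →₀ ℕ) (T c.1 c.2) ≤
        ∑ e ∈ μ.cells, (Finsupp.single (T e.1 e.2) 1 : ℕ →₀ ℕ) (T c.1 c.2) :=
      Finset.single_le_sum
        (f := fun e : ℕ × ℕ => (Finsupp.single (T e.1 e.2) 1 : ℕ →₀ ℕ) (T c.1 c.2))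
        (fun _ _ => Nat.zero_le _) hc
    rw [Finsupp.single_eq_same] at h2
    omega
  let F : {T : SemistandardYoungTableau μ // T.content = d} → (μ.cells → d.support) :=
    fun T c => ⟨T.1 c.1.1 c.1.2, key T.1 T.2 c.1 c.2⟩
  refine Finite.of_injective F ?_
  intro T U h
  apply Subtype.ext
  apply SemistandardYoungTableau.ext
  intro i j
  by_cases hc : (i, j) ∈ μ
  · have := congrFun h ⟨(i, j), (YoungDiagram.mem_cells _).2 hc⟩
    exact congrArg Subtype.val this
  · rw [T.1.zeros hc, U.1.zeros hc]

/-- The Schur function `s_μ = ∑_T x^T` in countably many variables, as a formal power series with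
integer coefficients: the coefficient of `x^d` is the number of semistandard Young tableaux of
shape `μ` and content `d`. (Tableau entries and variables are indexed from `0`.) -/
noncomputable def schur (μ : YoungDiagram) : MvPowerSeries ℕ ℤ :=
  fun d => (Nat.card {T : SemistandardYoungTableau μ // T.content = d} : ℤ)

/-- The Young diagram of the two-column partition `(2^a, 1^b)`. -/
def twoColumn (a b : ℕ) : YoungDiagram :=
  YoungDiagram.ofRowLens (List.replicate a 2 ++ List.replicate b 1) (by
    apply List.Pairwise.sortedGE
    rw [List.pairwise_append]
    refine ⟨List.pairwise_replicate.2 (Or.inr le_rfl), List.pairwise_replicate.2 (Or.inr le_rfl), ?_⟩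
    intro x hx y hy
    rw [List.eq_of_mem_replicate hx, List.eq_of_mem_replicate hy]
    norm_num)

/-- The Schur function `s_{(2^a, 1^b)}`, with the convention that it is `0` if `a < 0` or
`b < 0`. -/
noncomputable def schurTwo (a b : ℤ) : MvPowerSeries ℕ ℤ :=
  if 0 ≤ a ∧ 0 ≤ b then schur (twoColumn a.toNat b.toNat) else 0

/-- There are finitely many partitions of `n` with all parts in `S`. -/
theorem finite_partitionsIn (S : Set ℕ) (n : ℤ) :
    {μ : YoungDiagram | (μ.card : ℤ) = n ∧ ∀ r ∈ μ.rowLens, r ∈ S}.Finite := by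
  classical
  refine Set.Finite.of_finite_image (f := YoungDiagram.cells) ?_ ?_
  · refine (Finset.finite_toSet
      (Finset.range n.toNat ×ˢ Finset.range n.toNat).powerset).subset ?_
    rintro _ ⟨μ, ⟨hμ, -⟩, rfl⟩
    have hn : n.toNat = μ.cells.card := by
      have h : (μ.cells.card : ℤ) = n := hμ
      omega
    rw [Finset.mem_coe, Finset.mem_powerset]
    rintro ⟨i, j⟩ hc
    have hc' : (i, j) ∈ μ := (YoungDiagram.mem_cells _).1 hc
    have h1 : μ.colLen j ≤ μ.cells.card := by
      rw [YoungDiagram.colLen_eq_card]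
      exact Finset.card_le_card (Finset.filter_subset _ _)
    have h2 : μ.rowLen i ≤ μ.cells.card := by
      rw [YoungDiagram.rowLen_eq_card]
      exact Finset.card_le_card (Finset.filter_subset _ _)
    have h3 := YoungDiagram.mem_iff_lt_colLen.1 hc'
    have h4 := YoungDiagram.mem_iff_lt_rowLen.1 hc'
    rw [Finset.mem_product, Finset.mem_range, Finset.mem_range]
    exact ⟨by simpa [hn] using h3.trans_le h1, by simpa [hn] using h4.trans_le h2⟩
  · intro μ _ ν _ h
    exact YoungDiagram.ext h

/-- `Par_S(n)`: the finite set of partitions of the integer `n` all of whose parts belong to `S`.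
It is empty for `n < 0`. -/
noncomputable def partitionsIn (S : Set ℕ) (n : ℤ) : Finset YoungDiagram :=
  (finite_partitionsIn S n).toFinset

/-- `f` is `s`-positive: it has a (finite) expansion `f = ∑_μ a_μ s_μ` in Schur functions with all
coefficients `a_μ` nonnegative. -/
def IsSchurPositive (f : MvPowerSeries ℕ ℤ) : Prop :=
  ∃ a : YoungDiagram →₀ ℤ, (∀ μ, 0 ≤ a μ) ∧ f = a.sum fun μ c => c • schur μ

/-- The sum `∑_{i=0}^m (s_{(2^{i-1})} s_{(2^{m-i})} + s_{(2^{i-2},1^2)} s_{(2^{m-i})}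
- s_{(2^{i-1},1)} s_{(2^{m-i-1},1)})`. -/
noncomputable def schurSum (m : ℕ) : MvPowerSeries ℕ ℤ :=
  ∑ i ∈ Finset.range (m + 1),
    (schurTwo ((i : ℤ) - 1) 0 * schurTwo ((m : ℤ) - i) 0
      + schurTwo ((i : ℤ) - 2) 2 * schurTwo ((m : ℤ) - i) 0
      - schurTwo ((i : ℤ) - 1) 1 * schurTwo ((m : ℤ) - i - 1) 1)

/-! By the dual Jacobi–Trudi identity, `s_μ = det (e_{μ'_i - i + j})`, where `μ'` is the conjugate
partition, so both sides become polynomials in the elementary symmetric functions. Write `J(c)` for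
the determinant with column lengths `c`. The Schur functions on the left are 2×2 determinants. A
partition of `2m - 2` with parts 2 and 4 has conjugate `(a, a, b, b)` with `a + b = m - 1` and `a ≥
b`, so those on the right are the 4×4 determinants `J(a, a, b, b)`.

The sum of `J(m-1-b, m-1-b, b, b)` over all integers `b` is evaluated in two ways. Laplace expansion
along the first two rows gives six convolutions of 2×2 determinants, which coincide in pairs after
shifting the index: the result is twice the left-hand side (`finsum_jacobiTrudi_four`). On the other
hand, exchanging the two pairs of rows is an even permutation and amounts to `b ↦ m + 1 - b`. The
values of `b` left over in the middle give determinants with two equal rows, so the result is also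
twice the right-hand side (`finsum_jacobiTrudi_four_eq_sum`). Cancelling 2 proves the identity.

Dual Jacobi–Trudi itself is proved by induction on the number of variables
(`schurLT_eq_jacobiTrudi`): stripping off the largest entry removes a horizontal strip from the
tableau, and multilinearity in the rows produces the same recursion for the determinant. Power
series are recovered from their truncations to finitely many variables. -/

/-- The Jacobi–Trudi determinant `det (e (c i - i + j))`. -/
def jacobiTrudi {R : Type*} [CommRing R] {k : ℕ} (e : ℤ → R) (c : Fin k → ℤ) : R :=
  Matrix.det (Matrix.of fun i j : Fin k => e (c i - (i : ℕ) + (j : ℕ)))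

/-! ### Determinants of Jacobi–Trudi type for an arbitrary sequence -/

section JacobiTrudi

variable {R : Type*} [CommRing R] {k : ℕ}

theorem jacobiTrudi_eq_zero_of_rows_eq (e : ℤ → R) (c : Fin k → ℤ) {i j : Fin k} (hij : i ≠ j)
    (h : c i - (i : ℕ) = c j - (j : ℕ)) : jacobiTrudi e c = 0 := by
  refine Matrix.det_zero_of_row_eq hij ?_
  funext l
  simp [h]

theorem jacobiTrudi_eq_zero_of_row_neg (e : ℤ → R) (he : ∀ i < 0, e i = 0) (c : Fin k → ℤ)
    (i : Fin k) (h : c i - (i : ℕ) + k ≤ 0) : jacobiTrudi e c = 0 := by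
  refine Matrix.det_eq_zero_of_row_eq_zero i fun j => ?_
  have := j.2
  exact he _ (by omega)

/-- Row expansion of the Jacobi–Trudi determinant when one variable is added. -/
theorem jacobiTrudi_add (e e' : ℤ → R) (x : R) (he : ∀ i, e' i = e i + x * e (i - 1))
    (c : Fin k → ℤ) :
    jacobiTrudi e' c = ∑ s : Finset (Fin k),
      x ^ s.card * jacobiTrudi e (fun i => c i - if i ∈ s then 1 else 0) := by
  classical
  let r : (Fin k → ℤ) → Fin k → Fin k → R := fun c i j => e (c i - (i : ℕ) + (j : ℕ))
  have h1 : jacobiTrudi e' c =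
      (Matrix.detRowAlternating (R := R) (n := Fin k)).toMultilinearMap
        ((fun i => x • r (fun i => c i - 1) i) + r c) := by
    refine congrArg Matrix.det ?_
    ext i j
    simp only [Matrix.of_apply, Pi.add_apply, Pi.smul_apply, smul_eq_mul, r, he]
    rw [add_comm]
    congr 3
    ring
  rw [h1, MultilinearMap.map_add_univ]
  refine Finset.sum_congr rfl fun s _ => ?_
  -- Row `i` depends only on `c i`, so both choices of row can be read off one shifted family, with
  -- the scalar `x` exactly on `s`.
  have h2 : s.piecewise (fun i => x • r (fun i => c i - 1) i) (r c) =
      s.piecewise (fun i => x • r (fun i => c i - if i ∈ s then 1 else 0) i)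
        (r (fun i => c i - if i ∈ s then 1 else 0)) := by
    funext i
    by_cases hi : i ∈ s <;> simp [Finset.piecewise, hi, r]
  rw [h2, MultilinearMap.map_piecewise_smul, Finset.prod_const, smul_eq_mul]
  rfl

theorem jacobiTrudi_pair (e : ℤ → R) (a b : ℤ) :
    jacobiTrudi e ![a, b] = e a * e b - e (a + 1) * e (b - 1) := by
  simp [jacobiTrudi, Matrix.det_fin_two]

/-- Laplace expansion along the first two rows. -/
theorem jacobiTrudi_four (e : ℤ → R) (a b : ℤ) :
    jacobiTrudi e ![a, a, b, b] =
      jacobiTrudi e ![a, a] * jacobiTrudi e ![b, b]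
      - jacobiTrudi e ![a + 1, a] * jacobiTrudi e ![b, b - 1]
      + jacobiTrudi e ![a + 2, a] * jacobiTrudi e ![b - 1, b - 1]
      + jacobiTrudi e ![a + 1, a + 1] * jacobiTrudi e ![b, b - 2]
      - jacobiTrudi e ![a + 2, a + 1] * jacobiTrudi e ![b - 1, b - 2]
      + jacobiTrudi e ![a + 2, a + 2] * jacobiTrudi e ![b - 2, b - 2] := by
  simp only [jacobiTrudi_pair]
  rw [jacobiTrudi, Matrix.det_succ_row_zero]
  simp [Fin.sum_univ_succ, Matrix.det_fin_three, Fin.succAbove]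
  ring_nf

/-- The starting indices `c i - i` are `b-2, b-3, a, a-1` on the left and `a, a-1, b-2, b-3` on the
right: the two pairs of rows are exchanged, an even permutation. -/
theorem jacobiTrudi_four_swap (e : ℤ → R) (a b : ℤ) :
    jacobiTrudi e ![b - 2, b - 2, a + 2, a + 2] = jacobiTrudi e ![a, a, b, b] := by
  simp only [jacobiTrudi_four]
  ring_nf

end JacobiTrudi

/-! ### Convolutions over the integers -/

section Convolution

variable {R : Type*} [CommRing R]

theorem finite_support_convolution {f g : ℤ → R} (hf : ∀ i < 0, f i = 0) (hg : ∀ i < 0, g i = 0)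
    (x y : ℤ) : (Function.support fun b => f (x - b) * g (b + y)).Finite := by
  refine (Set.finite_Icc (-y) x).subset fun b hb => ?_
  rw [Function.mem_support] at hb
  constructor
  · by_contra h
    exact hb (by rw [hg _ (by omega), mul_zero])
  · by_contra h
    exact hb (by rw [hf _ (by omega), zero_mul])

theorem finsum_convolution_shift (f g : ℤ → R) (x y : ℤ) :
    ∑ᶠ b, f (x - b) * g (b + y) = ∑ᶠ b, f (x + y - b) * g b := by
  refine finsum_eq_of_bijective (fun b => b + y) (Equiv.addRight y).bijective fun b => ?_
  congr 2
  ring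

theorem finsum_convolution_comm (f g : ℤ → R) (x : ℤ) :
    ∑ᶠ b, f (x - b) * g b = ∑ᶠ b, g (x - b) * f b := by
  refine finsum_eq_of_bijective (fun b => x - b) (Equiv.subLeft x).bijective fun b => ?_
  rw [sub_sub_cancel, mul_comm]

theorem finsum_int_eq_sum_range {f : ℤ → R} (m : ℕ) (h0 : ∀ i < 0, f i = 0)
    (hm : ∀ i > (m : ℤ), f i = 0) : ∑ᶠ i, f i = ∑ i ∈ Finset.range (m + 1), f i := by
  rw [finsum_eq_sum_of_support_subset (s := (Finset.range (m + 1)).map Nat.castEmbedding),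
    Finset.sum_map]
  · rfl
  · intro i hi
    rw [Function.mem_support] at hi
    have h1 : ¬ i < 0 := fun h => hi (h0 i h)
    have h2 : ¬ i > m := fun h => hi (hm i h)
    simp only [Finset.coe_map, Set.mem_image, Finset.mem_coe, Finset.mem_range]
    exact ⟨i.toNat, by omega, by simp; omega⟩

end Convolution

/-! ### The determinantal identity -/

section Identity

variable {R : Type*} [CommRing R] {e : ℤ → R}

theorem jacobiTrudi_pair_eq_zero (he : ∀ i < 0, e i = 0) {a b : ℤ} (hb : b < 0) :
    jacobiTrudi e ![a, b] = 0 :=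
  by rw [jacobiTrudi_pair, he b hb, he (b - 1) (by omega)]; ring

theorem jacobiTrudi_four_eq_zero (he : ∀ i < 0, e i = 0) {a b : ℤ} (hb : b < 0) :
    jacobiTrudi e ![a, a, b, b] = 0 :=
  jacobiTrudi_eq_zero_of_row_neg e he _ 3 (by simp; omega)

/-- Summing over all integers makes every index shift harmless: the six Laplace terms become the
convolutions `P*P`, `Q*Q` and `P*T`, each occurring twice. -/
theorem finsum_jacobiTrudi_four (he : ∀ i < 0, e i = 0) (m : ℕ) :
    ∑ᶠ b : ℤ, jacobiTrudi e ![m - 1 - b, m - 1 - b, b, b] =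
      2 * ∑ᶠ i : ℤ, (jacobiTrudi e ![i - 1, i - 1] * jacobiTrudi e ![m - i, m - i]
        + jacobiTrudi e ![i, i - 2] * jacobiTrudi e ![m - i, m - i]
        - jacobiTrudi e ![i, i - 1] * jacobiTrudi e ![m - i, m - i - 1]) := by
  set P : ℤ → R := fun i => jacobiTrudi e ![i, i] with hP
  set Q : ℤ → R := fun i => jacobiTrudi e ![i, i - 1] with hQ
  set T : ℤ → R := fun i => jacobiTrudi e ![i, i - 2] with hT
  have P0 : ∀ i < 0, P i = 0 := fun i hi => jacobiTrudi_pair_eq_zero he hi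
  have Q0 : ∀ i < 0, Q i = 0 := fun i hi => jacobiTrudi_pair_eq_zero he (by omega)
  have T0 : ∀ i < 0, T i = 0 := fun i hi => jacobiTrudi_pair_eq_zero he (by omega)
  have hL : ∀ b : ℤ, jacobiTrudi e ![m - 1 - b, m - 1 - b, b, b] =
      P (m - 1 - b) * P (b + 0) - Q (m - b) * Q (b + 0) + T (m + 1 - b) * P (b + -1)
      + P (m - b) * T (b + 0) - Q (m + 1 - b) * Q (b + -1) + P (m + 1 - b) * P (b + -2) := by
    intro b
    rw [jacobiTrudi_four]
    simp only [hP, hQ, hT]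
    ring_nf
  have hR : ∀ i : ℤ, (jacobiTrudi e ![i - 1, i - 1] * jacobiTrudi e ![m - i, m - i]
        + jacobiTrudi e ![i, i - 2] * jacobiTrudi e ![m - i, m - i]
        - jacobiTrudi e ![i, i - 1] * jacobiTrudi e ![m - i, m - i - 1]) =
      P (m - i) * P (i + -1) + P (m - i) * T (i + 0) - Q (m - i) * Q (i + 0) := by
    intro i
    simp only [hP, hQ, hT]
    ring_nf
  simp only [hL, hR]
  have f1 := fun x y => finite_support_convolution P0 P0 x y
  have f2 := fun x y => finite_support_convolution Q0 Q0 x y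
  have f3 := fun x y => finite_support_convolution T0 P0 x y
  have f4 := fun x y => finite_support_convolution P0 T0 x y
  have hadd : ∀ {f g : ℤ → R}, (Function.support f).Finite → (Function.support g).Finite →
      (Function.support fun x => f x + g x).Finite :=
    fun hf hg => (hf.union hg).subset (Function.support_add _ _)
  have hsub : ∀ {f g : ℤ → R}, (Function.support f).Finite → (Function.support g).Finite →
      (Function.support fun x => f x - g x).Finite :=
    fun hf hg => (hf.union hg).subset (Function.support_sub _ _)
  have g1 := hsub (f1 (m - 1) 0) (f2 m 0)
  have g2 := hadd g1 (f3 (m + 1) (-1))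
  have g3 := hadd g2 (f4 m 0)
  have g4 := hsub g3 (f2 (m + 1) (-1))
  rw [finsum_add_distrib g4 (f1 _ _), finsum_sub_distrib g3 (f2 _ _),
    finsum_add_distrib g2 (f4 _ _), finsum_add_distrib g1 (f3 _ _),
    finsum_sub_distrib (f1 _ _) (f2 _ _),
    finsum_sub_distrib (hadd (f1 _ _) (f4 _ _)) (f2 _ _), finsum_add_distrib (f1 _ _) (f4 _ _)]
  simp only [finsum_convolution_shift]
  rw [finsum_convolution_comm T P]
  ring_nf

/-- The reflection `b ↦ m + 1 - b` preserves the summand and pairs `2 * b < m` with its mirror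
image; between the two lie only vanishing terms. -/
theorem finsum_jacobiTrudi_four_eq_sum (he : ∀ i < 0, e i = 0) (m : ℕ) :
    ∑ᶠ b : ℤ, jacobiTrudi e ![m - 1 - b, m - 1 - b, b, b] =
      2 * ∑ b ∈ Finset.range (m + 1) with 2 * b < m,
        jacobiTrudi e ![m - 1 - b, m - 1 - b, b, b] := by
  have hsymm : ∀ b : ℤ,
      jacobiTrudi e ![m - 1 - (m + 1 - b), m - 1 - (m + 1 - b), m + 1 - b, m + 1 - b] =
        jacobiTrudi e ![m - 1 - b, m - 1 - b, b, b] := by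
    intro b
    rw [← jacobiTrudi_four_swap]
    ring_nf
  have hneg : ∀ b : ℤ, b < 0 → jacobiTrudi e ![m - 1 - b, m - 1 - b, b, b] = 0 :=
    fun b hb => jacobiTrudi_four_eq_zero he hb
  have hmid : ∀ b : ℤ, ¬ 2 * b < m → ¬ 2 * (m + 1 - b) < m →
      jacobiTrudi e ![m - 1 - b, m - 1 - b, b, b] = 0 := by
    intro b h1 h2
    -- With `a = m - 1 - b`, these are `a = b - 1`, `b - 2`, `b - 3`; in each case one of the row
    -- starts `a, a-1` meets one of `b-2, b-3`.
    obtain h | h | h : 2 * b = m ∨ 2 * b = m + 1 ∨ 2 * b = m + 2 := by omega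
    · exact jacobiTrudi_eq_zero_of_rows_eq (i := 1) (j := 2) _ _ (by decide) (by simp; omega)
    · exact jacobiTrudi_eq_zero_of_rows_eq (i := 0) (j := 2) _ _ (by decide) (by simp; omega)
    · exact jacobiTrudi_eq_zero_of_rows_eq (i := 0) (j := 3) _ _ (by decide) (by simp; omega)
  rw [finsum_int_eq_sum_range (m + 1) hneg
    (fun i hi => by rw [← hsymm]; exact hneg _ (by push_cast at hi; omega)),
    ← Finset.sum_filter_add_sum_filter_not _ (fun b => 2 * b < m), two_mul]
  have hset : {b ∈ Finset.range (m + 1 + 1) | 2 * b < m} =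
      {b ∈ Finset.range (m + 1) | 2 * b < m} := by
    ext b
    simp only [Finset.mem_filter, Finset.mem_range]
    omega
  rw [hset]
  congr 1
  symm
  refine Finset.sum_of_injOn (fun b => m + 1 - b) ?_ ?_ ?_ ?_
  · intro a ha b hb h
    simp only [Finset.coe_filter, Finset.mem_range, Set.mem_ofPred_eq] at ha hb h
    omega
  · intro a ha
    simp only [Finset.coe_filter, Finset.mem_range, Set.mem_ofPred_eq] at ha ⊢
    omega
  · intro b hb hb'
    simp only [Finset.mem_filter, Finset.mem_range, Finset.coe_filter, Set.mem_image,
      Set.mem_ofPred_eq, not_exists, not_and] at hb hb'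
    refine hmid b (by omega) fun h => ?_
    exact hb' (m + 1 - b) (by omega) (by omega)
  · intro b hb
    simp only [Finset.mem_filter, Finset.mem_range] at hb
    rw [← hsymm, Nat.cast_sub (by omega)]
    push_cast
    rfl

/-- The identity underlying the expansion of the sum of products of two-column Schur functions. -/
theorem two_mul_sum_jacobiTrudi (he : ∀ i < 0, e i = 0) (m : ℕ) :
    2 * ∑ i ∈ Finset.range (m + 1),
      (jacobiTrudi e ![(i : ℤ) - 1, i - 1] * jacobiTrudi e ![(m : ℤ) - i, m - i]
        + jacobiTrudi e ![(i : ℤ), i - 2] * jacobiTrudi e ![(m : ℤ) - i, m - i]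
        - jacobiTrudi e ![(i : ℤ), i - 1] * jacobiTrudi e ![(m : ℤ) - i, m - i - 1]) =
      2 * ∑ b ∈ Finset.range (m + 1) with 2 * b < m,
        jacobiTrudi e ![(m : ℤ) - 1 - b, m - 1 - b, b, b] := by
  rw [← finsum_jacobiTrudi_four_eq_sum he, finsum_jacobiTrudi_four he,
    finsum_int_eq_sum_range m]
  · intro i hi
    rw [jacobiTrudi_pair_eq_zero he (a := i - 1) (by omega),
      jacobiTrudi_pair_eq_zero he (b := i - 2) (by omega),
      jacobiTrudi_pair_eq_zero he (b := i - 1) (by omega)]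
    ring
  · intro i hi
    rw [jacobiTrudi_pair_eq_zero he (b := m - i) (by omega),
      jacobiTrudi_pair_eq_zero he (b := m - i - 1) (by omega)]
    ring

end Identity

/-! ### Young diagrams through their column lengths -/

namespace YoungDiagram

theorem ext_colLen {μ ν : YoungDiagram} (h : ∀ j, μ.colLen j = ν.colLen j) : μ = ν := by
  refine SetLike.ext fun c => ?_
  rw [show c = (c.1, c.2) from rfl, mem_iff_lt_colLen, mem_iff_lt_colLen, h]

theorem le_iff_colLen_le {μ ν : YoungDiagram} : μ ≤ ν ↔ ∀ j, μ.colLen j ≤ ν.colLen j := by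
  constructor
  · intro h j
    by_contra! hj
    exact lt_irrefl _ (mem_iff_lt_colLen.1 (h (mem_iff_lt_colLen.2 hj)))
  · intro h c hc
    exact mem_iff_lt_colLen.2 ((mem_iff_lt_colLen.1 hc).trans_le (h _))

theorem colLen_eq_of_forall_mem_iff {μ : YoungDiagram} {j l : ℕ}
    (h : ∀ i, (i, j) ∈ μ ↔ i < l) : μ.colLen j = l := by
  have h' : ∀ i, i < μ.colLen j ↔ i < l := fun i => by rw [← mem_iff_lt_colLen, h]
  exact le_antisymm (not_lt.1 fun hl => lt_irrefl _ ((h' l).1 hl))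
    (not_lt.1 fun hl => lt_irrefl _ ((h' _).2 hl))

theorem colLen_eq_zero_of_le {μ : YoungDiagram} {j k : ℕ} (hk : μ.colLen k = 0) (h : k ≤ j) :
    μ.colLen j = 0 :=
  Nat.eq_zero_of_le_zero (hk ▸ μ.colLen_anti k j h)

theorem card_eq_sum_colLen {μ : YoungDiagram} {k : ℕ} (hk : μ.colLen k = 0) :
    μ.card = ∑ j : Fin k, μ.colLen j := by
  rw [Fin.sum_univ_eq_sum_range (fun j => μ.colLen j) k, YoungDiagram.card,
    Finset.card_eq_sum_card_fiberwise (f := Prod.snd) (t := Finset.range k)]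
  · exact Finset.sum_congr rfl fun j _ => μ.colLen_eq_card.symm
  · intro c hc
    rw [Finset.mem_coe, mem_cells] at hc
    rw [Finset.mem_coe, Finset.mem_range]
    by_contra! h
    have := mem_iff_lt_colLen.1 hc
    rw [colLen_eq_zero_of_le hk h] at this
    omega

end YoungDiagram

/-! ### Branching: removing the largest entry of a tableau -/

namespace SemistandardYoungTableau

variable {μ ν : YoungDiagram}

/-- The cells of a semistandard tableau whose entry is less than `n`. -/
def shapeLT (T : SemistandardYoungTableau μ) (n : ℕ) : YoungDiagram where
  cells := μ.cells.filter fun c => T c.1 c.2 < n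
  isLowerSet := by
    rintro ⟨i2, j2⟩ ⟨i1, j1⟩ ⟨hi : i1 ≤ i2, hj : j1 ≤ j2⟩ hc
    simp only [Finset.coe_filter, YoungDiagram.mem_cells, Set.mem_ofPred_eq] at hc ⊢
    have h1 := μ.up_left_mem hi le_rfl hc.1
    exact ⟨μ.up_left_mem le_rfl hj h1,
      (T.row_weak_of_le hj h1).trans_lt ((T.col_weak hi hc.1).trans_lt hc.2)⟩

theorem mem_shapeLT {T : SemistandardYoungTableau μ} {n : ℕ} {c : ℕ × ℕ} :
    c ∈ T.shapeLT n ↔ c ∈ μ ∧ T c.1 c.2 < n := by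
  rw [← YoungDiagram.mem_cells, shapeLT, Finset.mem_filter, YoungDiagram.mem_cells]

theorem shapeLT_le (T : SemistandardYoungTableau μ) (n : ℕ) : T.shapeLT n ≤ μ :=
  fun _ h => (mem_shapeLT.1 h).1

/-- The restriction of a semistandard tableau to a smaller shape. -/
def restrict (T : SemistandardYoungTableau μ) (h : ν ≤ μ) : SemistandardYoungTableau ν where
  entry i j := if (i, j) ∈ ν then T i j else 0
  row_weak' hj hc := by
    rw [if_pos hc, if_pos (ν.up_left_mem le_rfl hj.le hc)]
    exact T.row_weak hj (h hc)
  col_strict' hi hc := by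
    rw [if_pos hc, if_pos (ν.up_left_mem hi.le le_rfl hc)]
    exact T.col_strict hi (h hc)
  zeros' hc := if_neg hc

theorem restrict_apply (T : SemistandardYoungTableau μ) (h : ν ≤ μ) (i j : ℕ) :
    T.restrict h i j = if (i, j) ∈ ν then T i j else 0 :=
  rfl

/-- Extend a semistandard tableau with entries less than `n` by a horizontal strip of entries
`n`. -/
def extend (T : SemistandardYoungTableau ν) (n : ℕ) (hT : ∀ c ∈ ν, T c.1 c.2 < n)
    (hνμ : ν ≤ μ) (hstrip : ∀ i j, (i + 1, j) ∈ μ → (i, j) ∈ ν) :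
    SemistandardYoungTableau μ where
  entry i j := if (i, j) ∈ ν then T i j else if (i, j) ∈ μ then n else 0
  row_weak' {i j1 j2} hj hc := by
    by_cases h2 : (i, j2) ∈ ν
    · rw [if_pos h2, if_pos (ν.up_left_mem le_rfl hj.le h2)]
      exact T.row_weak hj h2
    · rw [if_neg h2, if_pos hc]
      split_ifs with h1
      · exact (hT _ h1).le
      · exact le_rfl
      · exact Nat.zero_le _
  col_strict' {i1 i2 j} hi hc := by
    have h1 : (i1, j) ∈ ν := hstrip _ _ (μ.up_left_mem hi le_rfl hc)
    rw [if_pos h1]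
    by_cases h2 : (i2, j) ∈ ν
    · rw [if_pos h2]
      exact T.col_strict hi h2
    · rw [if_neg h2, if_pos hc]
      exact hT _ h1
  zeros' hc := by rw [if_neg fun h => hc (hνμ h), if_neg hc]

theorem extend_apply (T : SemistandardYoungTableau ν) (n : ℕ) (hT : ∀ c ∈ ν, T c.1 c.2 < n)
    (hνμ : ν ≤ μ) (hstrip : ∀ i j, (i + 1, j) ∈ μ → (i, j) ∈ ν) (i j : ℕ) :
    T.extend n hT hνμ hstrip i j = if (i, j) ∈ ν then T i j else if (i, j) ∈ μ then n else 0 :=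
  rfl

/-- The semistandard tableaux of shape `μ` with entries less than `n`. -/
abbrev Bounded (n : ℕ) (μ : YoungDiagram) : Type :=
  {T : SemistandardYoungTableau μ // ∀ c ∈ μ, T c.1 c.2 < n}

instance (n : ℕ) (μ : YoungDiagram) : Finite (Bounded n μ) := by
  let F : Bounded n μ → μ.cells → Fin n :=
    fun T c => ⟨T.1 c.1.1 c.1.2, T.2 _ ((YoungDiagram.mem_cells _).1 c.2)⟩
  refine Finite.of_injective F fun T U h => Subtype.ext (ext fun i j => ?_)
  by_cases hc : (i, j) ∈ μ
  · exact congrArg Fin.val (congrFun h ⟨(i, j), (YoungDiagram.mem_cells _).2 hc⟩)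
  · rw [T.1.zeros hc, U.1.zeros hc]

noncomputable instance (n : ℕ) (μ : YoungDiagram) : Fintype (Bounded n μ) :=
  Fintype.ofFinite _

/-- Columns increase strictly, so a cell lying above another one has an entry below the maximal
value `n`. -/
theorem shapeLT_strip {n : ℕ} (T : Bounded (n + 1) μ) (i j : ℕ) (h : (i + 1, j) ∈ μ) :
    (i, j) ∈ T.1.shapeLT n :=
  mem_shapeLT.2 ⟨μ.up_left_mem (Nat.le_succ i) le_rfl h,
    (T.1.col_strict (Nat.lt_succ_self i) h).trans_le (Nat.lt_succ_iff.1 (T.2 _ h))⟩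

theorem content_eq_restrict_add {n : ℕ} (T : Bounded (n + 1) μ) (hν : T.1.shapeLT n = ν)
    (hνμ : ν ≤ μ) :
    T.1.content = (T.1.restrict hνμ).content + Finsupp.single n (μ.card - ν.card) := by
  have hsub : ν.cells ⊆ μ.cells := YoungDiagram.cells_subset_iff.2 hνμ
  rw [content, content, ← Finset.sum_sdiff hsub, add_comm]
  congr 1
  · refine Finset.sum_congr rfl fun c hc => ?_
    rw [restrict_apply, if_pos ((YoungDiagram.mem_cells _).1 hc)]
  · rw [Finset.sum_congr rfl (g := fun _ => Finsupp.single n 1), Finset.sum_const,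
      Finset.card_sdiff_of_subset hsub, Finsupp.smul_single, smul_eq_mul, mul_one]
    · intro c hc
      rw [Finset.mem_sdiff, YoungDiagram.mem_cells, YoungDiagram.mem_cells, ← hν,
        mem_shapeLT] at hc
      have := T.2 c hc.1
      refine congrArg (fun a => Finsupp.single a 1) ?_
      have h3 : ¬ T.1 c.1 c.2 < n := fun h => hc.2 ⟨hc.1, h⟩
      omega

/-- Restriction to `ν` is a bijection, inverted by filling `μ/ν` with `n`; each removed cell
contributes one factor `X n`. -/
theorem sum_monomial_shapeLT {n : ℕ} (hνμ : ν ≤ μ)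
    (hstrip : ∀ i j, (i + 1, j) ∈ μ → (i, j) ∈ ν) [DecidableEq YoungDiagram] :
    ∑ T : Bounded (n + 1) μ with T.1.shapeLT n = ν,
        MvPowerSeries.monomial (R := ℤ) T.1.content 1 =
      MvPowerSeries.X n ^ (μ.card - ν.card) *
        ∑ T : Bounded n ν, MvPowerSeries.monomial (R := ℤ) T.1.content 1 := by
  rw [Finset.mul_sum]
  refine Finset.sum_bij' (fun T hT => ⟨T.1.restrict hνμ, ?_⟩)
    (fun U _ => ⟨U.1.extend n U.2 hνμ hstrip, ?_⟩) ?_ ?_ ?_ ?_ ?_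
  · intro c hc
    rw [restrict_apply, if_pos hc]
    rw [← (Finset.mem_filter.1 hT).2] at hc
    exact (mem_shapeLT.1 hc).2
  · intro c hc
    rw [extend_apply]
    split_ifs with h
    · exact (U.2 c h).trans (Nat.lt_succ_self n)
    · exact Nat.lt_succ_self n
  · intro T hT
    exact Finset.mem_univ _
  · intro U _
    refine Finset.mem_filter.2 ⟨Finset.mem_univ _, SetLike.ext fun c => ?_⟩
    rw [mem_shapeLT, extend_apply]
    by_cases h : c ∈ ν
    · simp [h, hνμ h, U.2 c h]
    · by_cases h' : c ∈ μ <;> simp [h, h']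
  · intro T hT
    refine Subtype.ext (ext fun i j => ?_)
    rw [extend_apply, restrict_apply]
    have hν := (Finset.mem_filter.1 hT).2
    split_ifs with h h'
    · rfl
    · rw [← hν, mem_shapeLT] at h
      have := T.2 _ h'
      have h3 : ¬ T.1 i j < n := fun hlt => h ⟨h', hlt⟩
      simp only at this
      omega
    · exact (T.1.zeros h').symm
  · intro U _
    refine Subtype.ext (ext fun i j => ?_)
    rw [restrict_apply, extend_apply]
    split_ifs with h
    · rfl
    · exact (U.1.zeros h).symm
  · intro T hT
    rw [content_eq_restrict_add T (Finset.mem_filter.1 hT).2 hνμ, MvPowerSeries.X_pow_eq,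
      MvPowerSeries.monomial_mul_monomial, mul_one, add_comm]

end SemistandardYoungTableau

/-! ### The dual Jacobi–Trudi identity in finitely many variables -/

open SemistandardYoungTableau

/-- The Schur polynomial in the variables `x_i` with `i < n`. -/
noncomputable def schurLT (n : ℕ) (μ : YoungDiagram) : MvPowerSeries ℕ ℤ :=
  ∑ T : Bounded n μ, MvPowerSeries.monomial T.1.content 1

/-- The elementary symmetric polynomial of degree `k` in the variables `x_i` with `i < n`. -/
noncomputable def elemLT : ℕ → ℤ → MvPowerSeries ℕ ℤ
  | 0, k => if k = 0 then 1 else 0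
  | n + 1, k => elemLT n k + MvPowerSeries.X n * elemLT n (k - 1)

theorem elemLT_eq_zero (n : ℕ) : ∀ i < 0, elemLT n i = 0 := by
  induction n with
  | zero => exact fun i hi => if_neg hi.ne
  | succ n ih =>
    intro i hi
    rw [elemLT, ih i hi, ih (i - 1) (by omega), mul_zero, add_zero]

theorem schurLT_zero_bot : schurLT 0 ⊥ = 1 := by
  have : Unique (Bounded 0 ⊥) :=
    { default := ⟨highestWeight ⊥, fun c hc => (YoungDiagram.notMem_bot c hc).elim⟩
      uniq := fun T => Subtype.ext (SemistandardYoungTableau.ext fun i j => by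
        rw [T.1.zeros (YoungDiagram.notMem_bot _),
          SemistandardYoungTableau.zeros _ (YoungDiagram.notMem_bot _)]) }
  rw [schurLT, Fintype.sum_unique, content, YoungDiagram.cells_bot, Finset.sum_empty]
  rfl

theorem schurLT_zero_of_mem {μ : YoungDiagram} {c : ℕ × ℕ} (hc : c ∈ μ) : schurLT 0 μ = 0 := by
  have : IsEmpty (Bounded 0 μ) := ⟨fun T => absurd (T.2 c hc) (Nat.not_lt_zero _)⟩
  rw [schurLT, Finset.univ_eq_empty, Finset.sum_empty]

theorem jacobiTrudi_elemLT_zero_of_pos {k : ℕ} (c : Fin k → ℤ) (i : Fin k) (hi : (i : ℕ) = 0)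
    (hc : 0 < c i) : jacobiTrudi (elemLT 0) c = 0 := by
  refine Matrix.det_eq_zero_of_row_eq_zero i fun j => ?_
  exact if_neg (by omega)

theorem jacobiTrudi_elemLT_zero_zero (k : ℕ) :
    jacobiTrudi (elemLT 0) (fun _ : Fin k => 0) = 1 := by
  rw [jacobiTrudi, ← Matrix.det_one (n := Fin k)]
  congr 1
  ext1 i j
  rw [Matrix.of_apply, Matrix.one_apply, elemLT]
  refine if_congr ?_ rfl rfl
  rw [Fin.ext_iff]
  omega

/-- If removing the bottom cells of the columns in `s` from `μ` does not leave a Young diagram, the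
corresponding Jacobi–Trudi determinant vanishes. -/
theorem exists_colLen_or_jacobiTrudi_eq_zero {R : Type*} [CommRing R] {e : ℤ → R}
    (he : ∀ i < 0, e i = 0) {k : ℕ} (μ : YoungDiagram) (hk : μ.colLen k = 0)
    (s : Finset (Fin k)) :
    (∃ ν ≤ μ, ∀ j : Fin k, (ν.colLen j : ℤ) = μ.colLen j - if j ∈ s then 1 else 0) ∨
      jacobiTrudi e (fun j : Fin k => (μ.colLen j : ℤ) - if j ∈ s then 1 else 0) = 0 := by
  set c : Fin k → ℤ := fun j => (μ.colLen j : ℤ) - if j ∈ s then 1 else 0 with hc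
  obtain _ | k := k
  · exact Or.inl ⟨μ, le_rfl, fun j => j.elim0⟩
  by_cases hanti : Antitone c
  swap
  · right
    rw [Fin.antitone_iff_succ_le] at hanti
    push Not at hanti
    obtain ⟨i, hi⟩ := hanti
    -- Column lengths of `μ` decrease weakly and drop by at most 1, so a failure of monotonicity
    -- means `c (i+1) = c i + 1`: adjacent rows agree.
    refine jacobiTrudi_eq_zero_of_rows_eq e c (Fin.castSucc_lt_succ (i := i)).ne ?_
    have h1 := μ.colLen_anti i.castSucc i.succ (Fin.castSucc_lt_succ (i := i)).le
    have h2 : (i.succ : ℕ) = i.castSucc + 1 := by simp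
    simp only [hc] at hi ⊢
    split_ifs at hi ⊢ <;> omega
  by_cases hlast : 0 ≤ c (Fin.last k)
  swap
  · right
    refine jacobiTrudi_eq_zero_of_row_neg e he c (Fin.last k) ?_
    rw [Fin.val_last]
    push_cast
    omega
  left
  have hmem : ∀ i j : ℕ, (i, j) ∈ μ → j < k + 1 := by
    intro i j h
    by_contra! hj
    have := YoungDiagram.mem_iff_lt_colLen.1 h
    rw [YoungDiagram.colLen_eq_zero_of_le hk hj] at this
    omega
  -- Now `c` is weakly decreasing and nonnegative, hence is the list of column lengths of a diagram
  -- inside `μ`.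
  let ν : YoungDiagram :=
    { cells := μ.cells.filter fun x => ∀ h : x.2 < k + 1, (x.1 : ℤ) < c ⟨x.2, h⟩
      isLowerSet := by
        rintro ⟨i2, j2⟩ ⟨i1, j1⟩ ⟨hi : i1 ≤ i2, hj : j1 ≤ j2⟩ hx
        simp only [Finset.coe_filter, YoungDiagram.mem_cells, Set.mem_ofPred_eq] at hx ⊢
        refine ⟨μ.up_left_mem hi hj hx.1, fun h => ?_⟩
        have h2 := hmem _ _ hx.1
        have h3 : c ⟨j2, h2⟩ ≤ c ⟨j1, h⟩ := hanti hj
        have := hx.2 h2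
        omega }
  have hν : ∀ x, x ∈ ν ↔ x ∈ μ ∧ ∀ h : x.2 < k + 1, (x.1 : ℤ) < c ⟨x.2, h⟩ := by
    intro x
    rw [← YoungDiagram.mem_cells, Finset.mem_filter, YoungDiagram.mem_cells]
  refine ⟨ν, fun x hx => ((hν x).1 hx).1, fun j => ?_⟩
  have hj : 0 ≤ c j := hlast.trans (hanti (Fin.le_last j))
  rw [YoungDiagram.colLen_eq_of_forall_mem_iff (l := (c j).toNat), Int.toNat_of_nonneg hj]
  intro i
  rw [hν, YoungDiagram.mem_iff_lt_colLen]
  have hle : c j ≤ μ.colLen j := by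
    simp only [hc]
    split_ifs <;> omega
  constructor
  · intro h
    have : (i : ℤ) < c j := h.2 j.2
    omega
  · intro h
    have : (i : ℤ) < c j := by omega
    exact ⟨by omega, fun _ => this⟩

/-- The dual Jacobi–Trudi identity, in finitely many variables. -/
theorem schurLT_eq_jacobiTrudi (n : ℕ) {k : ℕ} (μ : YoungDiagram) (hk : μ.colLen k = 0) :
    schurLT n μ = jacobiTrudi (elemLT n) (fun j : Fin k => (μ.colLen j : ℤ)) := by
  classical
  induction n generalizing μ with
  | zero =>
    -- In zero variables `e_k` is 1 for `k = 0` and 0 otherwise: the empty shape gives the identity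
    -- matrix, any other shape a zero first row.
    by_cases h0 : μ.colLen 0 = 0
    · have hμ : μ = ⊥ := YoungDiagram.ext_colLen fun j => by
        rw [YoungDiagram.colLen_eq_zero_of_le h0 (Nat.zero_le j),
          YoungDiagram.colLen_eq_of_forall_mem_iff (l := 0)]
        exact fun i => iff_of_false (YoungDiagram.notMem_bot _) (Nat.not_lt_zero i)
      rw [funext fun j : Fin k => congrArg Nat.cast
        (YoungDiagram.colLen_eq_zero_of_le h0 (Nat.zero_le (j : ℕ))), hμ, schurLT_zero_bot]
      exact (jacobiTrudi_elemLT_zero_zero k).symm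
    · obtain _ | k := k
      · exact absurd hk h0
      · rw [schurLT_zero_of_mem (YoungDiagram.mem_iff_lt_colLen.2 (Nat.pos_of_ne_zero h0)),
          jacobiTrudi_elemLT_zero_of_pos _ 0 rfl]
        exact_mod_cast Nat.pos_of_ne_zero h0
  | succ n ih =>
    -- `S T` is the set of columns containing the entry `n`, each exactly once; it indexes the terms
    -- of `jacobiTrudi_add`.
    let S : Bounded (n + 1) μ → Finset (Fin k) :=
      fun T => {j | (T.1.shapeLT n).colLen j < μ.colLen j}
    have hS : ∀ T, ∀ j : Fin k, ((T.1.shapeLT n).colLen j : ℤ) =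
        μ.colLen j - if j ∈ S T then 1 else 0 := by
      intro T j
      have h1 := YoungDiagram.le_iff_colLen_le.1 (T.1.shapeLT_le n) j
      have h2 : μ.colLen j ≤ (T.1.shapeLT n).colLen j + 1 := by
        by_contra! h
        have := YoungDiagram.mem_iff_lt_colLen.1
          (shapeLT_strip T _ _ (YoungDiagram.mem_iff_lt_colLen.2 h))
        omega
      simp only [S, Finset.mem_filter, Finset.mem_univ, true_and]
      split_ifs <;> omega
    rw [jacobiTrudi_add (elemLT n) (elemLT (n + 1)) (MvPowerSeries.X n) (fun i => rfl), schurLT,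
      ← Finset.sum_fiberwise Finset.univ S]
    refine Finset.sum_congr rfl fun s _ => ?_
    by_cases hν : ∃ ν ≤ μ, ∀ j : Fin k, (ν.colLen j : ℤ) = μ.colLen j - if j ∈ s then 1 else 0
    · obtain ⟨ν, hνμ, hν⟩ := hν
      have hνk : ν.colLen k = 0 :=
        Nat.eq_zero_of_le_zero (hk ▸ YoungDiagram.le_iff_colLen_le.1 hνμ k)
      have hfib : ∀ T, S T = s ↔ T.1.shapeLT n = ν := by
        intro T
        constructor
        · rintro rfl
          refine YoungDiagram.ext_colLen fun j => ?_
          by_cases hj : j < k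
          · have h1 := hS T ⟨j, hj⟩
            have h2 := hν ⟨j, hj⟩
            exact_mod_cast h1.trans h2.symm
          · rw [YoungDiagram.colLen_eq_zero_of_le hνk (not_lt.1 hj)]
            refine Nat.eq_zero_of_le_zero ?_
            rw [← YoungDiagram.colLen_eq_zero_of_le hk (not_lt.1 hj)]
            exact YoungDiagram.le_iff_colLen_le.1 (T.1.shapeLT_le n) j
        · rintro rfl
          ext j
          have h1 := hν j
          simp only [S, Finset.mem_filter, Finset.mem_univ, true_and]
          split_ifs at h1 with h
          · exact iff_of_true (by omega) h
          · exact iff_of_false (by omega) h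
      have hstrip : ∀ i j, (i + 1, j) ∈ μ → (i, j) ∈ ν := by
        intro i j h
        rw [YoungDiagram.mem_iff_lt_colLen] at h ⊢
        by_cases hj : j < k
        · have h2 := hν ⟨j, hj⟩
          simp only at h2
          split_ifs at h2 <;> omega
        · rw [YoungDiagram.colLen_eq_zero_of_le hk (not_lt.1 hj)] at h
          omega
      have hcard : μ.card - ν.card = s.card := by
        have h1 : (ν.card : ℤ) = μ.card - s.card := by
          rw [YoungDiagram.card_eq_sum_colLen hk, YoungDiagram.card_eq_sum_colLen hνk]
          push_cast
          rw [Finset.sum_congr rfl fun j _ => hν j, Finset.sum_sub_distrib]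
          simp
        omega
      simp only [hfib]
      rw [sum_monomial_shapeLT hνμ hstrip, hcard, ← funext hν, ← ih ν hνk, schurLT]
    -- When `s` does not come from a subdiagram, the determinant vanishes and no tableau has `S T =
    -- s`.
    · rw [(exists_colLen_or_jacobiTrudi_eq_zero (elemLT_eq_zero n) μ hk s).resolve_left hν,
        mul_zero]
      refine Finset.sum_eq_zero fun T hT => ?_
      rw [Finset.mem_filter] at hT
      exact absurd ⟨_, T.1.shapeLT_le n, hT.2 ▸ hS T⟩ hν

/-! ### Passage from finitely many to countably many variables -/

theorem SemistandardYoungTableau.mem_support_content {μ : YoungDiagram}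
    (T : SemistandardYoungTableau μ) (k : ℕ) :
    k ∈ T.content.support ↔ ∃ c ∈ μ, T c.1 c.2 = k := by
  rw [Finsupp.mem_support_iff, content, Finsupp.finsetSum_apply, Ne, Finset.sum_eq_zero_iff]
  simp [Finsupp.single_apply]

/-- Setting the variables `x_i` with `n ≤ i` to zero. -/
noncomputable def truncVars (n : ℕ) : MvPowerSeries ℕ ℤ →+* MvPowerSeries ℕ ℤ :=
  MvPowerSeries.rescale fun i => if i < n then 1 else 0

theorem coeff_truncVars (n : ℕ) (f : MvPowerSeries ℕ ℤ) (d : ℕ →₀ ℕ) :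
    MvPowerSeries.coeff d (truncVars n f) =
      if ∀ i ∈ d.support, i < n then MvPowerSeries.coeff d f else 0 := by
  rw [truncVars, MvPowerSeries.coeff_rescale, Finsupp.prod]
  split_ifs with h
  · rw [Finset.prod_eq_one, one_mul]
    intro i hi
    rw [if_pos (h i hi), one_pow]
  · push Not at h
    obtain ⟨i, hi, hin⟩ := h
    rw [Finset.prod_eq_zero hi, zero_mul]
    rw [if_neg (by omega), zero_pow (Finsupp.mem_support_iff.1 hi)]

/-- A single monomial involves finitely many variables, so some truncation retains its coefficient.
-/
theorem eq_of_truncVars_eq {f g : MvPowerSeries ℕ ℤ} (h : ∀ n, truncVars n f = truncVars n g) :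
    f = g := by
  ext d
  have h1 := congrArg (MvPowerSeries.coeff d) (h (d.support.sup id + 1))
  have h2 : ∀ i ∈ d.support, i < d.support.sup id + 1 :=
    fun i hi => Nat.lt_succ_of_le (Finset.le_sup (f := id) hi)
  rwa [coeff_truncVars, coeff_truncVars, if_pos h2, if_pos h2] at h1

theorem truncVars_schur (n : ℕ) (μ : YoungDiagram) : truncVars n (schur μ) = schurLT n μ := by
  classical
  ext d
  rw [coeff_truncVars, schurLT, map_sum]
  simp only [MvPowerSeries.coeff_monomial]
  rw [Finset.sum_boole]
  split_ifs with h
  · change (Nat.card {T : SemistandardYoungTableau μ // T.content = d} : ℤ) = _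
    rw [Nat.cast_inj, ← Fintype.card_subtype, ← Nat.card_eq_fintype_card]
    refine Nat.card_congr
      { toFun := fun T => ⟨⟨T.1, fun c hc => h _ ?_⟩, T.2.symm⟩
        invFun := fun T => ⟨T.1.1, T.2.symm⟩
        left_inv := fun T => rfl
        right_inv := fun T => rfl }
    have hT := (mem_support_content T.1 _).2 ⟨c, hc, rfl⟩
    rwa [T.2] at hT
  · rw [Finset.filter_eq_empty_iff.2, Finset.card_empty, Nat.cast_zero]
    rintro T - rfl
    refine h fun i hi => ?_
    obtain ⟨c, hc, rfl⟩ := (mem_support_content T.1 i).1 hi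
    exact T.2 c hc

theorem truncVars_schur_eq_jacobiTrudi (n : ℕ) {k : ℕ} {μ : YoungDiagram} (c : Fin k → ℤ)
    (hk : μ.colLen k = 0) (hc : ∀ j : Fin k, (μ.colLen j : ℤ) = c j) :
    truncVars n (schur μ) = jacobiTrudi (elemLT n) c := by
  rw [truncVars_schur, schurLT_eq_jacobiTrudi n μ hk, funext hc]

/-! ### Two-column shapes and shapes with parts 2 and 4 -/

theorem mem_twoColumn (a b i j : ℕ) :
    (i, j) ∈ twoColumn a b ↔ (j = 0 ∧ i < a + b) ∨ (j = 1 ∧ i < a) := by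
  rw [twoColumn, YoungDiagram.mem_ofRowLens]
  simp only [List.length_append, List.length_replicate, List.getElem_append,
    List.getElem_replicate]
  constructor
  · rintro ⟨h, hj⟩
    split_ifs at hj <;> omega
  · intro h
    refine ⟨by omega, ?_⟩
    split_ifs <;> omega

theorem truncVars_schurTwo (n : ℕ) {a b c : ℤ} (hb : 0 ≤ b) (hc : c = a + b) :
    truncVars n (schurTwo a b) = jacobiTrudi (elemLT n) ![c, a] := by
  subst hc
  rw [schurTwo]
  split_ifs with h
  · refine truncVars_schur_eq_jacobiTrudi n _ ?_ ?_
    · exact YoungDiagram.colLen_eq_of_forall_mem_iff fun i => by rw [mem_twoColumn]; omega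
    · rw [Fin.forall_fin_two]
      constructor
      · rw [YoungDiagram.colLen_eq_of_forall_mem_iff (l := a.toNat + b.toNat)
          fun i => by rw [mem_twoColumn]; simp]
        simp
        omega
      · rw [YoungDiagram.colLen_eq_of_forall_mem_iff (l := a.toNat)
          fun i => by rw [mem_twoColumn]; simp]
        simp
        omega
  -- For `a < 0` the second row is zero, which agrees with the convention for `schurTwo`.
  · rw [map_zero, jacobiTrudi_pair_eq_zero (elemLT_eq_zero n) (by omega)]

theorem mem_partitionsIn {S : Set ℕ} {n : ℤ} {μ : YoungDiagram} :
    μ ∈ partitionsIn S n ↔ (μ.card : ℤ) = n ∧ ∀ r ∈ μ.rowLens, r ∈ S := by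
  rw [partitionsIn, Set.Finite.mem_toFinset, Set.mem_ofPred_eq]

theorem YoungDiagram.rowLens_mem_iff {S : Set ℕ} {μ : YoungDiagram} :
    (∀ r ∈ μ.rowLens, r ∈ S) ↔ ∀ i < μ.colLen 0, μ.rowLen i ∈ S := by
  simp [YoungDiagram.rowLens]

/-- The differences of columns 0, 1 and of columns 2, 3 count the rows of length 1 and of length 3;
column 4 counts the rows of length at least 5. -/
theorem YoungDiagram.rowLens_mem_two_four_iff {μ : YoungDiagram} :
    (∀ r ∈ μ.rowLens, r ∈ ({2, 4} : Set ℕ)) ↔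
      μ.colLen 0 = μ.colLen 1 ∧ μ.colLen 2 = μ.colLen 3 ∧ μ.colLen 4 = 0 := by
  have key : ∀ i j, j < μ.rowLen i ↔ i < μ.colLen j := fun i j => by
    rw [← YoungDiagram.mem_iff_lt_rowLen, YoungDiagram.mem_iff_lt_colLen]
  rw [YoungDiagram.rowLens_mem_iff]
  simp only [Set.mem_insert_iff, Set.mem_singleton_iff]
  constructor
  · intro h
    have h1 := μ.colLen_anti 0 1 (by omega)
    have h3 := μ.colLen_anti 2 3 (by omega)
    have h2 := μ.colLen_anti 0 2 (by omega)
    have h4 := μ.colLen_anti 0 4 (by omega)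
    refine ⟨?_, ?_, ?_⟩
    · by_contra hne
      have := h (μ.colLen 1) (by omega)
      have := key (μ.colLen 1) 1
      omega
    · by_contra hne
      have := h (μ.colLen 3) (by omega)
      have := key (μ.colLen 3) 3
      have := key (μ.colLen 3) 2
      omega
    · by_contra hne
      have := h 0 (by omega)
      have := key 0 4
      omega
  · rintro ⟨h1, h2, h3⟩ i hi
    have := key i 1
    have := key i 2
    have := key i 3
    have := key i 4
    omega

/-- The partition whose conjugate is `(a, a, b, b)`. -/
def doubledColumns (a b : ℕ) (h : b ≤ a) : YoungDiagram where
  cells := Finset.range a ×ˢ Finset.range 2 ∪ Finset.range b ×ˢ Finset.range 4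
  isLowerSet := by
    rintro ⟨i2, j2⟩ ⟨i1, j1⟩ ⟨hi : i1 ≤ i2, hj : j1 ≤ j2⟩ hx
    simp only [Finset.mem_coe, Finset.mem_union, Finset.mem_product, Finset.mem_range] at hx ⊢
    omega

theorem colLen_doubledColumns {a b : ℕ} (h : b ≤ a) (j : ℕ) :
    (doubledColumns a b h).colLen j = if j < 2 then a else if j < 4 then b else 0 := by
  refine YoungDiagram.colLen_eq_of_forall_mem_iff fun i => ?_
  rw [← YoungDiagram.mem_cells, doubledColumns]
  simp only [Finset.mem_union, Finset.mem_product, Finset.mem_range]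
  split_ifs <;> omega

/-- Such a partition is determined by `b`, its number of parts 4, and `2 * b < m` expresses `b ≤ m -
1 - b`. This also keeps the natural subtraction exact; for `m = 0` both sums are empty. -/
theorem sum_partitionsIn_two_four {M : Type*} [AddCommMonoid M] (m : ℕ) (f : YoungDiagram → M)
    (g : ℕ → M) (hfg : ∀ (μ : YoungDiagram) (b : ℕ), 2 * b < m → μ.colLen 0 = m - 1 - b →
      μ.colLen 1 = m - 1 - b → μ.colLen 2 = b → μ.colLen 3 = b → μ.colLen 4 = 0 → f μ = g b) :
    ∑ μ ∈ partitionsIn {2, 4} (2 * (m : ℤ) - 2), f μ =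
      ∑ b ∈ Finset.range (m + 1) with 2 * b < m, g b := by
  have key : ∀ μ ∈ partitionsIn {2, 4} (2 * (m : ℤ) - 2), 2 * μ.colLen 2 < m ∧
      μ.colLen 0 = m - 1 - μ.colLen 2 ∧ μ.colLen 1 = m - 1 - μ.colLen 2 ∧
      μ.colLen 3 = μ.colLen 2 ∧ μ.colLen 4 = 0 := by
    intro μ hμ
    rw [mem_partitionsIn, YoungDiagram.rowLens_mem_two_four_iff] at hμ
    obtain ⟨hcard, h1, h2, h4⟩ := hμ
    rw [YoungDiagram.card_eq_sum_colLen h4, Fin.sum_univ_four] at hcard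
    have := μ.colLen_anti 0 2 (by omega)
    simp at hcard
    omega
  refine Finset.sum_bij (fun μ _ => μ.colLen 2) ?_ ?_ ?_ ?_
  · intro μ hμ
    have := key μ hμ
    simp only [Finset.mem_filter, Finset.mem_range]
    omega
  · intro μ hμ ν hν h
    have h1 := key μ hμ
    have h2 := key ν hν
    refine YoungDiagram.ext_colLen fun j => ?_
    rcases j with _ | _ | _ | _ | j
    · rw [h1.2.1, h2.2.1, h]
    · rw [h1.2.2.1, h2.2.2.1, h]
    · exact h
    · rw [h1.2.2.2.1, h2.2.2.2.1, h]
    · rw [YoungDiagram.colLen_eq_zero_of_le h1.2.2.2.2 (by omega),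
        YoungDiagram.colLen_eq_zero_of_le h2.2.2.2.2 (by omega)]
  · intro b hb
    simp only [Finset.mem_filter, Finset.mem_range] at hb
    have hle : b ≤ m - 1 - b := by omega
    refine ⟨doubledColumns (m - 1 - b) b hle, ?_, by simp [colLen_doubledColumns]⟩
    rw [mem_partitionsIn, YoungDiagram.rowLens_mem_two_four_iff]
    refine ⟨?_, by simp [colLen_doubledColumns], by simp [colLen_doubledColumns],
      by simp [colLen_doubledColumns]⟩
    rw [YoungDiagram.card_eq_sum_colLen (k := 4) (by simp [colLen_doubledColumns]),
      Fin.sum_univ_four]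
    simp [colLen_doubledColumns]
    omega
  · intro μ hμ
    obtain ⟨h, h0, h1, h3, h4⟩ := key μ hμ
    exact hfg μ _ h h0 h1 rfl h3 h4

/-! ### The Schur expansion and positivity -/

theorem schurSum_eq (m : ℕ) :
    schurSum m = ∑ μ ∈ partitionsIn {2, 4} (2 * (m : ℤ) - 2), schur μ := by
  refine eq_of_truncVars_eq fun n => ?_
  rw [map_sum, sum_partitionsIn_two_four m _
    (fun b => jacobiTrudi (elemLT n) ![(m : ℤ) - 1 - b, m - 1 - b, b, b])]
  -- The determinantal identity carries a factor 2 on both sides, cancelled here because integer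
  -- power series have no zero divisors.
  · have h2 : (2 : MvPowerSeries ℕ ℤ) ≠ 0 := fun h => by
      have := congrArg (MvPowerSeries.constantCoeff (σ := ℕ) (R := ℤ)) h
      rw [map_ofNat, map_zero] at this
      exact two_ne_zero this
    refine mul_left_cancel₀ h2 ?_
    rw [← two_mul_sum_jacobiTrudi (elemLT_eq_zero n), schurSum, map_sum]
    congr 1
    refine Finset.sum_congr rfl fun i _ => ?_
    rw [map_sub, map_add, map_mul, map_mul, map_mul,
      truncVars_schurTwo n (c := i - 1) le_rfl (by ring),
      truncVars_schurTwo n (c := m - i) le_rfl (by ring),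
      truncVars_schurTwo n (c := i) zero_le_two (by ring),
      truncVars_schurTwo n (c := i) zero_le_one (by ring),
      truncVars_schurTwo n (c := m - i) zero_le_one (by ring)]
  · intro μ b hb h0 h1 h2 h3 h4
    refine truncVars_schur_eq_jacobiTrudi n _ h4 ?_
    intro j
    fin_cases j <;> simp [h0, h1, h2, h3] <;> omega

theorem isSchurPositive_sum (s : Finset YoungDiagram) : IsSchurPositive (∑ μ ∈ s, schur μ) := by
  classical
  refine ⟨Finsupp.indicator s fun _ _ => 1, fun μ => ?_, ?_⟩
  · rw [Finsupp.indicator_apply]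
    split_ifs <;> simp
  · rw [Finsupp.sum_of_support_subset _ (Finsupp.support_indicator_subset s _)
      (fun μ c => c • schur μ) fun _ _ => zero_smul _ _]
    refine Finset.sum_congr rfl fun μ hμ => ?_
    rw [Finsupp.indicator_of_mem hμ, one_smul]

theorem mainTheorem6 (m : ℕ) :
    schurSum m = ∑ μ ∈ partitionsIn {2, 4} (2 * (m : ℤ) - 2), schur μ ∧
      IsSchurPositive (schurSum m) := by
  rw [schurSum_eq]
  exact ⟨rfl, isSchurPositive_sum _⟩
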